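/- Let $n\ge 1$. Let $MA(n,\mathbb C)$ be the set of affine maps $f(x)=Ax+a$ of $\mathbb C^n$, where $A\in M_n(\mathbb C)$ and $a\in\mathbb C^n$ (write $f=(A,a)$), and let $GA(n,\mathbb C)$ be the group of invertible ones. For $f=(A,a)$ put $$\Phi(f)=\begin{bmatrix}1&0\\ a&A\end{bmatrix},\qquad \Psi(f)=\begin{bmatrix}0&0\\ a&A\end{bmatrix}\in M_{n+1}(\mathbb C).$$ For a tuple $\eta=(n_1,\dots,n_r)$ of positive integers with $n_1+\dots+n_r=n+1$, let $\mathcal K_{\eta,r}(\mathbb C)=\mathbb T_{n_1}(\mathbb C)\oplus\dots\oplus\mathbb T_{n_r}(\mathbb C)$ be the algebra of block-diagonal matrices, where $\mathbb T_m(\mathbb C)$ is the set of lower triangular $m\times m$ matrices with all diagonal entries equal. Let $u_0=(e_{1,1},\dots,e_{r,1})\in\mathbb C^{n+1}$ with $e_{k,1}=(1,0,\dots,0)\in\mathbb C^{n_k}$, and let $p_2:\mathbb C\times\mathbb C^n\to\mathbb C^n$ be the second projection. Let $\mathcal G$ be an abelian sub-semigroup (under composition) of $MA(n,\mathbb C)$.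 Then there exist $\eta$ as above and $P\in\Phi(GA(n,\mathbb C))$ such that $P^{-1}\Phi(\mathcal G)P\subset\mathcal K_{\eta,r}(\mathbb C)$. Moreover, for every such choice of $\eta$ and $P$, put $w_0=p_2(Pu_0)$ and $$\mathfrak q=\{f\in MA(n,\mathbb C):\ e^{\Psi(f)}\in\Phi(\mathcal G)\ \text{ and }\ \Psi(f)\in P\,\mathcal K_{\eta,r}(\mathbb C)\,P^{-1}\},\qquad \mathfrak q_{w_0}=\{f(w_0):\ f\in\mathfrak q\}.$$ Then the following are equivalent: (i) $\mathcal G$ is hypercyclic, i.e. there is $v\in\mathbb C^n$ such that $\mathcal G(v)=\{f(v): f\in\mathcal G\}$ is dense in $\mathbb C^n$; (ii) the orbit $\mathcal G(w_0)$ is dense in $\mathbb C^n$; (iii) $\mathfrak q_{w_0}$ is an additive sub-semigroup of $\mathbb C^n$ and is dense in $\mathbb C^n$. -/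

import Mathlib

namespace AffineSemigroup

/-- The affine maps `f(x) = A x + a` of `ℂⁿ`. They form a monoid under composition
(`f * g = f ∘ g`) and a complex vector space under pointwise operations. -/
abbrev MA (n : ℕ) : Type := (Fin n → ℂ) →ᵃ[ℂ] (Fin n → ℂ)

/-- The invertible affine maps of `ℂⁿ`. -/
abbrev GA (n : ℕ) : Type := (Fin n → ℂ) ≃ᵃ[ℂ] (Fin n → ℂ)

/-- The matrix `[c 0; a A]` attached to the affine map `x ↦ A x + a` and the corner entry `c`. -/
def blockMatrix {n : ℕ} (c : ℂ) (f : MA n) : Matrix (Fin (n + 1)) (Fin (n + 1)) ℂ :=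
  Matrix.of (Fin.cons (Fin.cons c 0)
    (fun i => Fin.cons (f 0 i) (LinearMap.toMatrix' f.linear i)))

/-- `Φ(A, a) = [1 0; a A]`. -/
def Phi {n : ℕ} (f : MA n) : Matrix (Fin (n + 1)) (Fin (n + 1)) ℂ := blockMatrix 1 f

/-- `Ψ(A, a) = [0 0; a A]`. -/
def Psi {n : ℕ} (f : MA n) : Matrix (Fin (n + 1)) (Fin (n + 1)) ℂ := blockMatrix 0 f

/-- For `η = (n₁, …, n_r)` with all `n_k ≥ 1` and `n₁ + ⋯ + n_r = m`, the set
`𝕋_{n₁}(ℂ) ⊕ ⋯ ⊕ 𝕋_{n_r}(ℂ)` of block diagonal matrices whose `k`-th diagonal block is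
`n_k × n_k`, lower triangular, with a constant diagonal. -/
def blockAlgebra {m : ℕ} (η : Composition m) : Set (Matrix (Fin m) (Fin m) ℂ) :=
  {M | (∀ i j, η.index i ≠ η.index j → M i j = 0) ∧
       (∀ i j, i < j → M i j = 0) ∧
       (∀ i j, η.index i = η.index j → M i i = M j j)}

/-- The vector `u₀ = (e_{1,1}, …, e_{r,1})`: its coordinates are `1` at the first position of
every block of `η`, and `0` elsewhere. -/
def u₀ {m : ℕ} (η : Composition m) : Fin m → ℂ :=
  fun i => if (η.invEmbedding i : ℕ) = 0 then 1 else 0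

/-- The pair `(η, φ)` brings the semigroup `𝒢` to normal form: with `P = Φ(φ)`, one has
`P⁻¹ Φ(𝒢) P ⊆ 𝕋_{n₁}(ℂ) ⊕ ⋯ ⊕ 𝕋_{n_r}(ℂ)`. -/
def IsNormalForm {n : ℕ} (𝒢 : Subsemigroup (MA n)) (η : Composition (n + 1)) (φ : GA n) : Prop :=
  ∀ f ∈ 𝒢, (Phi (φ : MA n))⁻¹ * Phi f * Phi (φ : MA n) ∈ blockAlgebra η

/-- `w₀ = p₂(P u₀)`, where `P = Φ(φ)` and `p₂` forgets the first coordinate. -/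
def w₀ {n : ℕ} (η : Composition (n + 1)) (φ : GA n) : Fin n → ℂ :=
  Fin.tail (Matrix.mulVec (Phi (φ : MA n)) (u₀ η))

/-- `g = exp⁻¹(Φ(𝒢)) ∩ P (𝕋_{n₁}(ℂ) ⊕ ⋯ ⊕ 𝕋_{n_r}(ℂ)) P⁻¹`, where `P = Φ(φ)`. -/
def logs {n : ℕ} (𝒢 : Subsemigroup (MA n)) (η : Composition (n + 1)) (φ : GA n) :
    Set (Matrix (Fin (n + 1)) (Fin (n + 1)) ℂ) :=
  {B | NormedSpace.exp B ∈ Phi '' (𝒢 : Set (MA n))} ∩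
    (fun M => Phi (φ : MA n) * M * (Phi (φ : MA n))⁻¹) '' blockAlgebra η

/-- `𝔮 = Ψ⁻¹(g¹)`, where `g¹ = g ∩ Ψ(MA(n, ℂ))`. -/
def affineLogs {n : ℕ} (𝒢 : Subsemigroup (MA n)) (η : Composition (n + 1)) (φ : GA n) :
    Set (MA n) :=
  Psi ⁻¹' (logs 𝒢 η φ ∩ Set.range (Psi (n := n)))

/-- For a set `S` of affine maps, `S_v = {f(v) : f ∈ S}`; for a semigroup this is the orbit
of `v`. -/
def orbit {n : ℕ} (S : Set (MA n)) (v : Fin n → ℂ) : Set (Fin n → ℂ) := {y | ∃ f ∈ S, f v = y}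

/-- Some vector has a dense orbit. -/
def IsHypercyclic {n : ℕ} (𝒢 : Subsemigroup (MA n)) : Prop :=
  ∃ v : Fin n → ℂ, Dense (orbit (𝒢 : Set (MA n)) v)

end AffineSemigroup

/-!
Suppose `P⁻¹ Φ(𝒢) P` lies in a block algebra. There `ad B` is nilpotent, so whatever commutes with
`exp B` commutes with `B`; hence `Φ(𝒢)` and `Ψ(𝔮)` generate a commutative algebra `𝒜` of matrices
`[c 0; a A]`. If one of the orbits `𝒢(w)`, `𝔮_w` is dense, then `(1, w)` is a cyclic vector of `𝒜`,
and evaluation at `(1, w)` is an isomorphism of `𝒜` with `ℂⁿ⁺¹` that takes the slices `c = 0` and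
`c = 1` to `ℂⁿ`. The exponential maps the first slice to the second; it is continuous and open, and
its range is dense because the units of `𝒜` all have logarithms. The preimage of the points of
`Φ(𝒢)` under it is `Ψ(𝔮)`, so density passes both ways between `𝒢(w)` and `𝔮_w`.

If `𝒢(x)` is dense, some `β ∈ 𝒜` maps `(1, x)` to `(1, w₀)`. As `u₀` does not vanish at the first
position of any block, `β` is invertible; since it commutes with `Φ(𝒢)`, it carries the orbit of
`x` to the orbit of `w₀`.

The normal form comes from the simultaneous generalized eigenspaces of `Φ(𝒢)`. The first coordinate
is a fixed functional, so it vanishes on all of them but the one of weight `1`, which is placed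
first.
-/

namespace AffineSemigroup

open Filter Topology NormedSpace Module
open scoped Matrix Matrix.Norms.Operator

section Exponential

variable {A : Type*} [NormedRing A] [NormedAlgebra ℂ A]

-- Mathlib states these facts for normed `ℚ`-algebras.

lemma exp_add_of_commute_complex [CompleteSpace A] {a b : A} (h : Commute a b) :
    exp (a + b) = exp a * exp b := by
  let := NormedAlgebra.restrictScalars ℚ ℂ A
  exact exp_add_of_commute h

lemma continuous_exp_complex [CompleteSpace A] : Continuous (exp : A → A) := by
  let := NormedAlgebra.restrictScalars ℚ ℂ A
  exact exp_continuous

lemma isUnit_exp_complex [CompleteSpace A] (a : A) : IsUnit (exp a) := by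
  let := NormedAlgebra.restrictScalars ℚ ℂ A
  exact isUnit_exp a

lemma map_exp_complex [CompleteSpace A] {B : Type*} [NormedRing B] [NormedAlgebra ℂ B]
    (f : A →ₐ[ℂ] B) (hf : Continuous f) (a : A) : f (exp a) = exp (f a) := by
  let := NormedAlgebra.restrictScalars ℚ ℂ A
  let := NormedAlgebra.restrictScalars ℚ ℂ B
  exact map_exp f hf a

lemma coe_exp_subalgebra {S : Subalgebra ℂ A} [FiniteDimensional ℂ S] (a : S) :
    (exp a : S) = exp (a : A) := by
  have := FiniteDimensional.complete ℂ S
  exact map_exp_complex S.val continuous_subtype_val a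

lemma finite_spectrum [FiniteDimensional ℂ A] (a : A) : (spectrum ℂ a).Finite := by
  refine (Module.End.finite_spectrum (Algebra.lmul ℂ A a)).subset fun z hz hu ↦ hz ?_
  rwa [spectrum.mem_resolventSet_iff, ← AlgHom.commutes (Algebra.lmul ℂ A), ← map_sub,
    Algebra.lmul_isUnit_iff] at hu

lemma finite_setOf_not_isUnit_lineMap_one [FiniteDimensional ℂ A] (a : A) :
    {t : ℂ | ¬ IsUnit (AffineMap.lineMap 1 a t)}.Finite := by
  refine ((finite_spectrum (1 - a)).image (·⁻¹)).subset fun t ht ↦ ⟨t⁻¹, fun hu ↦ ht ?_, inv_inv t⟩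
  have ht0 : t ≠ 0 := fun h ↦ ht (by simp [h])
  have hline : AffineMap.lineMap 1 a t = algebraMap ℂ A t * (algebraMap ℂ A t⁻¹ - (1 - a)) := by
    rw [mul_sub, ← map_mul, mul_inv_cancel₀ ht0, map_one, ← Algebra.smul_def,
      AffineMap.lineMap_apply_module', ← neg_sub, smul_neg]
    abel
  rw [hline]
  exact (ht0.isUnit.map _).mul hu

variable [IsMulCommutative A]

lemma isOpenMap_exp [CompleteSpace A] : IsOpenMap (exp : A → A) := by
  let : NormedCommRing A := { ‹NormedRing A› with mul_comm := mul_comm' }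
  refine isOpenMap_iff_nhds_le.2 fun a ↦ ?_
  have hderiv : HasStrictFDerivAt exp (exp a • (1 : A →L[ℂ] A)) a := hasStrictFDerivAt_exp
  refine (hderiv.map_nhds_eq_of_surj ?_).ge
  obtain ⟨u, hu⟩ := isUnit_exp_complex a
  exact LinearMap.range_eq_top.2 fun y ↦ ⟨↑u⁻¹ * y, by simp [← hu]⟩

lemma mem_range_exp_of_mem_closure [CompleteSpace A] {a : A} (ha : IsUnit a)
    (h : a ∈ closure (Set.range exp)) : a ∈ Set.range exp := by
  obtain ⟨u, rfl⟩ := ha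
  have hopen : IsOpen ((u • ·) '' Set.range (exp : A → A)) :=
    isOpenMap_smul u _ isOpenMap_exp.isOpen_range
  obtain ⟨_, ⟨_, ⟨b, rfl⟩, hb⟩, c, rfl⟩ :=
    mem_closure_iff.1 h _ hopen ⟨1, ⟨0, exp_zero⟩, mul_one (u : A)⟩
  refine ⟨c - b, (isUnit_exp_complex b).mul_right_cancel ?_⟩
  rw [← exp_add_of_commute_complex (mul_comm' _ _), sub_add_cancel]
  exact hb.symm

variable [FiniteDimensional ℂ A]

-- The range of `exp` is open, and closed in the group of units, so it contains the units on the
-- complex line through `1` and `a`: they form a connected set, a plane minus finitely many points.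
lemma mem_range_exp_of_isUnit {a : A} (ha : IsUnit a) : a ∈ Set.range exp := by
  have := FiniteDimensional.complete ℂ A
  let U : Set ℂ := {t | ¬ IsUnit (AffineMap.lineMap 1 a t)}ᶜ
  have hU : IsPreconnected U :=
    ((finite_setOf_not_isUnit_lineMap_one a).countable.isPathConnected_compl_of_one_lt_rank
      (by rw [Complex.rank_real_complex]; exact Cardinal.one_lt_two)).isConnected.isPreconnected
  have hcont : Continuous (AffineMap.lineMap 1 a : ℂ → A) := AffineMap.lineMap_continuous
  have hsub : U ⊆ AffineMap.lineMap 1 a ⁻¹' Set.range exp := by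
    refine hU.subset_of_closure_inter_subset (isOpenMap_exp.isOpen_range.preimage hcont)
      ⟨0, by simp [U], 0, by simp⟩ fun t ⟨ht, htU⟩ ↦ ?_
    exact mem_range_exp_of_mem_closure (not_not.1 htU) (hcont.closure_preimage_subset _ ht)
  have h1 : (1 : ℂ) ∈ U := by simpa [U] using ha
  simpa using hsub h1

end Exponential

section Character

variable {A : Type*} [NormedRing A] [NormedAlgebra ℂ A] [FiniteDimensional ℂ A] (χ : A →ₐ[ℂ] ℂ)

lemma continuous_character : Continuous χ :=
  χ.toLinearMap.continuous_of_finiteDimensional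

lemma character_exp (a : A) : χ (exp a) = exp (χ a) := by
  have := FiniteDimensional.complete ℂ A
  exact map_exp_complex χ (continuous_character χ) a

/-- The exponential of `A`, as a map from the kernel of the character `χ` to the set where `χ`
takes the value `1`. -/
noncomputable def expKer (a : {a : A // χ a = 0}) : {a : A // χ a = 1} :=
  ⟨exp a.1, by rw [character_exp, a.2, exp_zero]⟩

lemma continuous_expKer : Continuous (expKer χ) := by
  have := FiniteDimensional.complete ℂ A
  exact (continuous_exp_complex.comp continuous_subtype_val).subtype_mk _

/-- The projection of `A` onto the kernel of the character `χ` along the scalars. -/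
noncomputable def projKer (a : A) : {a : A // χ a = 0} :=
  ⟨a - algebraMap ℂ A (χ a), by simp⟩

lemma continuous_projKer : Continuous (projKer χ) :=
  (continuous_id.sub ((continuous_algebraMap ℂ A).comp (continuous_character χ))).subtype_mk _

omit [FiniteDimensional ℂ A] in
lemma projKer_coe (a : {a : A // χ a = 0}) : projKer χ a = a := by
  ext
  simp [projKer, a.2]

lemma expKer_projKer {a : A} (h : χ (exp a) = 1) : (expKer χ (projKer χ a) : A) = exp a := by
  have := FiniteDimensional.complete ℂ A
  have hexp : exp (algebraMap ℂ A (χ a)) = 1 := by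
    rw [← algebraMap_exp_comm, ← character_exp, h, map_one]
  calc exp (a - algebraMap ℂ A (χ a))
      = exp (a - algebraMap ℂ A (χ a)) * exp (algebraMap ℂ A (χ a)) := by rw [hexp, mul_one]
    _ = exp a := by
      rw [← exp_add_of_commute_complex (Algebra.commute_algebraMap_right _ _), sub_add_cancel]

variable [IsMulCommutative A]

lemma isOpenMap_expKer : IsOpenMap (expKer χ) := by
  have := FiniteDimensional.complete ℂ A
  intro V hV
  refine ⟨_, isOpenMap_exp _ (hV.preimage (continuous_projKer χ)), Set.ext fun b ↦ ⟨?_, ?_⟩⟩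
  · rintro ⟨a, ha, hab⟩
    exact ⟨_, ha, Subtype.ext ((expKer_projKer χ (hab ▸ b.2)).trans hab)⟩
  · rintro ⟨a, ha, rfl⟩
    exact ⟨a, by rwa [Set.mem_preimage, projKer_coe], rfl⟩

lemma denseRange_expKer : DenseRange (expKer χ) := by
  intro a
  have hline (t : ℂ) : χ (AffineMap.lineMap 1 a.1 t) = 1 := by
    simp [AffineMap.lineMap_apply_module', a.2]
  let line : ℂ → {a : A // χ a = 1} := fun t ↦ ⟨AffineMap.lineMap 1 a.1 t, hline t⟩
  have hcont : Continuous line := AffineMap.lineMap_continuous.subtype_mk _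
  have hmem : closure {t | ¬ IsUnit (AffineMap.lineMap 1 a.1 t)}ᶜ ⊆
      line ⁻¹' closure (Set.range (expKer χ)) := by
    refine closure_minimal (fun t ht ↦ subset_closure ?_) (isClosed_closure.preimage hcont)
    obtain ⟨b, hb⟩ := mem_range_exp_of_isUnit (not_not.1 ht)
    exact ⟨projKer χ b, Subtype.ext ((expKer_projKer χ (by rw [hb, hline])).trans hb)⟩
  have h1 := hmem ((finite_setOf_not_isUnit_lineMap_one a.1).countable.dense_compl ℝ 1)
  have hline1 : line 1 = a := Subtype.ext (AffineMap.lineMap_apply_one _ _)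
  rwa [Set.mem_preimage, hline1] at h1

end Character

lemma dense_preimage_iff {X Y : Type*} [TopologicalSpace X] [TopologicalSpace Y] {f : X → Y}
    (hcont : Continuous f) (hopen : IsOpenMap f) (hrange : DenseRange f) {s : Set Y} :
    Dense (f ⁻¹' s) ↔ Dense s :=
  ⟨fun h ↦ (hrange.dense_image hcont h).mono (Set.image_preimage_subset f s),
    fun h ↦ h.preimage hopen⟩

section Commutation

section Ring

variable {R : Type*} [Ring R]

lemma pow_succ_lie {a x : R} (h : Commute a ⁅a, x⁆) (k : ℕ) :
    ⁅a ^ (k + 1), x⁆ = (k + 1) • (a ^ k * ⁅a, x⁆) := by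
  induction k with
  | zero => simp
  | succ k ih =>
    calc ⁅a ^ (k + 2), x⁆ = a ^ (k + 1) * ⁅a, x⁆ + ⁅a ^ (k + 1), x⁆ * a := by
          simp only [Ring.lie_def, pow_succ]; noncomm_ring
      _ = (k + 2) • (a ^ (k + 1) * ⁅a, x⁆) := by
          rw [ih, smul_mul_assoc, mul_assoc, ← h.eq, ← mul_assoc, ← pow_succ, add_comm,
            ← succ_nsmul]

lemma commute_iterate_lie {a b c : R} (hba : Commute b a) (hbc : Commute b c) (k : ℕ) :
    Commute b ((⁅a, ·⁆)^[k] c) := by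
  induction k with
  | zero => exact hbc
  | succ k ih =>
    rw [Function.iterate_succ_apply', Ring.lie_def]
    exact (hba.mul_right ih).sub_right (ih.mul_right hba)

end Ring

variable {A : Type*} [NormedRing A] [NormedAlgebra ℂ A] [CompleteSpace A] {a c : A}

lemma exp_lie {x : A} (h : Commute a ⁅a, x⁆) : ⁅exp a, x⁆ = exp a * ⁅a, x⁆ := by
  have hexp : HasSum (fun k : ℕ ↦ (k.factorial : ℂ)⁻¹ • a ^ k) (exp a) :=
    exp_series_hasSum_exp' (𝕂 := ℂ) a
  have hlie : HasSum (fun k : ℕ ↦ (k.factorial : ℂ)⁻¹ • ⁅a ^ k, x⁆) ⁅exp a, x⁆ := by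
    simpa only [Ring.lie_def, smul_sub, smul_mul_assoc, mul_smul_comm]
      using (hexp.mul_right x).sub (hexp.mul_left x)
  have hshift := (hasSum_nat_add_iff' 1).2 hlie
  simp only [Finset.sum_range_one, pow_zero, (Commute.one_left x).lie_eq, smul_zero,
    sub_zero] at hshift
  refine hshift.unique ?_
  convert! hexp.mul_right ⁅a, x⁆ using 2 with k
  rw [pow_succ_lie h, ← Nat.cast_smul_eq_nsmul ℂ, smul_smul, smul_mul_assoc, Nat.factorial_succ]
  congr 1
  push_cast
  field_simp

-- If `⁅a, ⁅a, x⁆⁆ = 0` and `x` commutes with `exp a`, then `exp a * ⁅a, x⁆ = ⁅exp a, x⁆ = 0`, so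
-- the order of vanishing of the iterated brackets of `c` can be lowered down to `1`.
lemma commute_of_commute_exp (h : Commute (exp a) c) {m : ℕ} (hm : (⁅a, ·⁆)^[m] c = 0) :
    Commute a c := by
  have descent (k : ℕ) (hk : (⁅a, ·⁆)^[k + 2] c = 0) : (⁅a, ·⁆)^[k + 1] c = 0 := by
    rw [Function.iterate_succ_apply', Function.iterate_succ_apply', ← commute_iff_lie_eq] at hk
    rw [Function.iterate_succ_apply', ← (isUnit_exp_complex a).mul_right_eq_zero, ← exp_lie hk]
    exact (commute_iterate_lie (Commute.refl a).exp_left h k).lie_eq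
  induction m with
  | zero =>
    rw [show c = 0 from hm]
    exact Commute.zero_right a
  | succ k ih =>
    cases k with
    | zero => exact commute_iff_lie_eq.2 hm
    | succ k => exact ih (descent k hm)

end Commutation

section Triangular

variable {ι R : Type*} [Fintype ι] [LinearOrder ι] [NonUnitalNonAssocSemiring R]
  {M N : Matrix ι ι R} {i j : ι}

lemma mul_apply_eq_diag_mul (hM : ∀ l, i < l → M i l = 0) (hN : ∀ l, l < i → N l j = 0) :
    (M * N) i j = M i i * N i j := by
  rw [Matrix.mul_apply]
  refine Finset.sum_eq_single i (fun l _ hl ↦ ?_) (by simp)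
  rcases hl.lt_or_gt with h | h
  · rw [hN l h, mul_zero]
  · rw [hM l h, zero_mul]

lemma mul_apply_eq_mul_diag (hM : ∀ l, j < l → M i l = 0) (hN : ∀ l, l < j → N l j = 0) :
    (M * N) i j = M i j * N j j := by
  rw [Matrix.mul_apply]
  refine Finset.sum_eq_single j (fun l _ hl ↦ ?_) (by simp)
  rcases hl.lt_or_gt with h | h
  · rw [hN l h, mul_zero]
  · rw [hM l h, zero_mul]

end Triangular

section BlockAlgebra

variable {m : ℕ}

/-- `blockAlgebra η` as a subalgebra of the matrix algebra. -/
def blockSubalgebra (η : Composition m) : Subalgebra ℂ (Matrix (Fin m) (Fin m) ℂ) where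
  carrier := blockAlgebra η
  mul_mem' := by
    rintro M N ⟨hM, hM_lower, hM_diag⟩ ⟨hN, hN_lower, hN_diag⟩
    have hdiag (i : Fin m) : (M * N) i i = M i i * N i i :=
      mul_apply_eq_diag_mul (hM_lower i) fun l ↦ hN_lower l i
    refine ⟨fun i j hij ↦ ?_, fun i j hij ↦ ?_, fun i j hij ↦ ?_⟩
    · rw [Matrix.mul_apply]
      refine Finset.sum_eq_zero fun l _ ↦ ?_
      by_cases h : η.index i = η.index l
      · rw [hN l j (h ▸ hij), mul_zero]
      · rw [hM i l h, zero_mul]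
    · exact Matrix.BlockTriangular.mul (b := OrderDual.toDual) hM_lower hN_lower hij
    · rw [hdiag, hdiag, hM_diag i j hij, hN_diag i j hij]
  add_mem' := by
    rintro M N ⟨hM, hM_lower, hM_diag⟩ ⟨hN, hN_lower, hN_diag⟩
    exact ⟨fun i j hij ↦ by simp [hM i j hij, hN i j hij],
      fun i j hij ↦ by simp [hM_lower i j hij, hN_lower i j hij],
      fun i j hij ↦ by simp [hM_diag i j hij, hN_diag i j hij]⟩
  algebraMap_mem' c :=
    ⟨fun i j hij ↦ by simp [Matrix.algebraMap_matrix_apply, show i ≠ j by grind],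
      fun i j hij ↦ by simp [Matrix.algebraMap_matrix_apply, hij.ne],
      fun i j _ ↦ by simp [Matrix.algebraMap_matrix_apply]⟩

variable {η : Composition m} {B C : Matrix (Fin m) (Fin m) ℂ}

lemma lie_apply_eq_zero (hB : B ∈ blockSubalgebra η) (hC : C ∈ blockSubalgebra η) {k : ℕ}
    (hk : ∀ i j : Fin m, (i : ℕ) < j + k → C i j = 0) {i j : Fin m} (hij : (i : ℕ) < j + (k + 1)) :
    ⁅B, C⁆ i j = 0 := by
  rw [Ring.lie_def, Matrix.sub_apply,
    mul_apply_eq_diag_mul (hB.2.1 i) fun l hl ↦ hk l j (by omega),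
    mul_apply_eq_mul_diag (fun l hl ↦ hk i l (by omega)) fun l ↦ hB.2.1 l j]
  by_cases h : η.index i = η.index j
  · rw [hB.2.2 i j h, mul_comm, sub_self]
  · rw [hC.1 i j h, mul_zero, zero_mul, sub_zero]

lemma iterate_lie_apply_eq_zero (hB : B ∈ blockSubalgebra η) (hC : C ∈ blockSubalgebra η) (k : ℕ) :
    (⁅B, ·⁆)^[k] C ∈ blockSubalgebra η ∧
      ∀ i j : Fin m, (i : ℕ) < j + k → ((⁅B, ·⁆)^[k] C) i j = 0 := by
  induction k with
  | zero => exact ⟨hC, fun i j hij ↦ hC.2.1 i j hij⟩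
  | succ k ih =>
    rw [Function.iterate_succ_apply']
    exact ⟨sub_mem (mul_mem hB ih.1) (mul_mem ih.1 hB), fun i j ↦ lie_apply_eq_zero hB ih.1 ih.2⟩

lemma commute_of_commute_exp_of_mem_blockSubalgebra (hB : B ∈ blockSubalgebra η)
    (hC : C ∈ blockSubalgebra η) (h : Commute (exp B) C) : Commute B C := by
  refine commute_of_commute_exp h (m := m) ?_
  ext i j
  exact (iterate_lie_apply_eq_zero hB hC m).2 i j (by omega)

lemma mulVec_apply_of_invEmbedding_eq_zero (hB : B ∈ blockSubalgebra η) {i : Fin m}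
    (hi : (η.invEmbedding i : ℕ) = 0) (x : Fin m → ℂ) : (B *ᵥ x) i = B i i * x i := by
  rw [Matrix.mulVec, dotProduct]
  refine Finset.sum_eq_single_of_mem i (Finset.mem_univ i) fun l _ hl ↦ ?_
  rcases hl.lt_or_gt with hlt | hlt
  · have hindex : η.index i ≠ η.index l := by
      intro h
      have hl := η.sizeUpTo_index_le l
      have hsub := η.coe_invEmbedding i
      rw [← h] at hl
      omega
    rw [hB.1 i l hindex, zero_mul]
  · rw [hB.2.1 i l hlt, zero_mul]

lemma isUnit_of_mulVec_eq_u₀ (hB : B ∈ blockSubalgebra η) {x : Fin m → ℂ} (hx : B *ᵥ x = u₀ η) :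
    IsUnit B := by
  have hdiag (i : Fin m) : B i i ≠ 0 := by
    let first : Fin m := η.embedding (η.index i) ⟨0, η.one_le_blocksFun _⟩
    have hfirst : (η.invEmbedding first : ℕ) = 0 := η.invEmbedding_comp _ _
    have hmul : B first first * x first = 1 := by
      rw [← mulVec_apply_of_invEmbedding_eq_zero hB hfirst, hx, u₀, if_pos hfirst]
    rw [hB.2.2 i first (η.index_embedding _ _).symm]
    exact left_ne_zero_of_mul_eq_one hmul
  rw [Matrix.isUnit_iff_isUnit_det, Matrix.det_of_isLowerTriangular B hB.2.1, isUnit_iff_ne_zero]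
  exact Finset.prod_ne_zero_iff.2 fun i _ ↦ hdiag i

end BlockAlgebra

section Representation

variable {n : ℕ} {M N : Matrix (Fin (n + 1)) (Fin (n + 1)) ℂ}

/-- The algebra of the matrices `[c 0; a A]`. -/
def cornerSubalgebra (n : ℕ) : Subalgebra ℂ (Matrix (Fin (n + 1)) (Fin (n + 1)) ℂ) where
  carrier := {M | ∀ j : Fin n, M 0 j.succ = 0}
  mul_mem' hM hN j := by
    rw [Set.mem_ofPred_eq] at hM hN
    simp [Matrix.mul_apply, Fin.sum_univ_succ, hM, hN]
  add_mem' hM hN j := by rw [Matrix.add_apply, hM j, hN j, add_zero]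
  algebraMap_mem' c j := by simp [Matrix.algebraMap_matrix_apply, (Fin.succ_ne_zero j).symm]

lemma mulVec_apply_zero (hM : M ∈ cornerSubalgebra n) (x : Fin (n + 1) → ℂ) :
    (M *ᵥ x) 0 = M 0 0 * x 0 := by
  simp [Matrix.mulVec, dotProduct, Fin.sum_univ_succ, show ∀ j : Fin n, M 0 j.succ = 0 from hM]

/-- The corner entry `c` of `[c 0; a A]`, as a character. -/
def cornerCharacter (n : ℕ) : cornerSubalgebra n →ₐ[ℂ] ℂ where
  toFun M := M.1 0 0
  map_one' := rfl
  map_mul' M N := by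
    simp [Matrix.mul_apply, Fin.sum_univ_succ, show ∀ j : Fin n, M.1 0 j.succ = 0 from M.2]
  map_zero' := rfl
  map_add' _ _ := rfl
  commutes' c := by simp [Matrix.algebraMap_matrix_apply]

lemma eq_top_of_cons_mem {p : Submodule ℂ (Fin (n + 1) → ℂ)} {c : ℂ} {w : Fin n → ℂ}
    (hp : ∀ x : Fin n → ℂ, Fin.cons c x ∈ p) (hw : Fin.cons 1 w ∈ p) : p = ⊤ := by
  refine eq_top_iff.2 fun y _ ↦ ?_
  have hy : y = y 0 • (Fin.cons 1 w : Fin (n + 1) → ℂ) +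
      ((Fin.cons c (Fin.tail y - y 0 • w) : Fin (n + 1) → ℂ) - Fin.cons c 0) := by
    ext i
    cases i using Fin.cases <;> simp [Fin.tail]
  rw [hy]
  exact p.add_mem (p.smul_mem _ hw) (p.sub_mem (hp _) (hp _))

lemma matrix_ext_mulVec_cons (h : ∀ x : Fin n → ℂ, M *ᵥ Fin.cons 1 x = N *ᵥ Fin.cons 1 x) :
    M = N := by
  refine Matrix.toLin'.injective (LinearMap.eqLocus_eq_top.1 ?_)
  exact eq_top_of_cons_mem (c := 1) (w := 0) h (h 0)

lemma blockMatrix_mulVec_cons (c : ℂ) (f : MA n) (x : Fin n → ℂ) :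
    blockMatrix c f *ᵥ Fin.cons 1 x = Fin.cons c (f x) := by
  ext i
  cases i using Fin.cases with
  | zero => simp [blockMatrix, Matrix.mulVec, dotProduct, Fin.sum_univ_succ]
  | succ i =>
    have hlinear : ∑ j, LinearMap.toMatrix' f.linear i j * x j = f.linear x i :=
      congrFun (LinearMap.toMatrix'_mulVec f.linear x) i
    simp [blockMatrix, Matrix.mulVec, dotProduct, Fin.sum_univ_succ, -LinearMap.toMatrix'_apply,
      hlinear, congrFun f.decomp x, add_comm]

lemma Phi_mulVec (f : MA n) (x : Fin n → ℂ) : Phi f *ᵥ Fin.cons 1 x = Fin.cons 1 (f x) :=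
  blockMatrix_mulVec_cons 1 f x

lemma Psi_mulVec (f : MA n) (x : Fin n → ℂ) : Psi f *ᵥ Fin.cons 1 x = Fin.cons 0 (f x) :=
  blockMatrix_mulVec_cons 0 f x

lemma blockMatrix_mem_cornerSubalgebra (c : ℂ) (f : MA n) : blockMatrix c f ∈ cornerSubalgebra n :=
  fun _ ↦ rfl

lemma exists_blockMatrix_eq (hM : M ∈ cornerSubalgebra n) :
    ∃ f : MA n, blockMatrix (M 0 0) f = M := by
  let f : MA n := (Matrix.toLin' (M.submatrix Fin.succ Fin.succ)).toAffineMap +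
    AffineMap.const ℂ _ fun i ↦ M i.succ 0
  refine ⟨f, Matrix.ext fun i j ↦ ?_⟩
  cases i using Fin.cases <;> cases j using Fin.cases <;>
    simp [f, blockMatrix, show ∀ j : Fin n, M 0 j.succ = 0 from hM]

lemma Psi_add (f g : MA n) : Psi (f + g) = Psi f + Psi g := by
  refine matrix_ext_mulVec_cons fun x ↦ ?_
  simp only [Matrix.add_mulVec, Psi_mulVec]
  ext i
  cases i using Fin.cases <;> simp

lemma Phi_mul (f g : MA n) : Phi (f * g) = Phi f * Phi g := by
  refine matrix_ext_mulVec_cons fun x ↦ ?_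
  simp only [← Matrix.mulVec_mulVec, Phi_mulVec]
  rfl

/-- `Φ` as a homomorphism from the monoid of affine maps. -/
def PhiHom (n : ℕ) : MA n →* Matrix (Fin (n + 1)) (Fin (n + 1)) ℂ where
  toFun := Phi
  map_one' := matrix_ext_mulVec_cons fun x ↦ by rw [Phi_mulVec, Matrix.one_mulVec]; rfl
  map_mul' := Phi_mul

/-- `Φ` on invertible affine maps, with values in the units of the matrix algebra. -/
def PhiUnit (φ : GA n) : (Matrix (Fin (n + 1)) (Fin (n + 1)) ℂ)ˣ :=
  Units.map (PhiHom n) (AffineEquiv.equivUnitsAffineMap φ)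

lemma exists_PhiUnit_eq (hM : M ∈ cornerSubalgebra n) (h1 : M 0 0 = 1) (hu : IsUnit M) :
    ∃ φ : GA n, PhiUnit φ = M := by
  obtain ⟨f, hf⟩ := exists_blockMatrix_eq hM
  have hmulVec (x : Fin n → ℂ) : M *ᵥ Fin.cons 1 x = Fin.cons 1 (f x) := by
    rw [← blockMatrix_mulVec_cons, ← h1, hf]
  have hinj : Function.Injective f := fun x y hxy ↦
    (Fin.cons_inj.1 (Matrix.mulVec_injective_of_isUnit hu (by rw [hmulVec, hmulVec, hxy]))).2
  have hsurj : Function.Surjective f := by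
    intro y
    obtain ⟨x, hx⟩ := Matrix.mulVec_surjective_iff_isUnit.2 hu (Fin.cons 1 y)
    have hx0 : x 0 = 1 := by simpa [mulVec_apply_zero hM, h1] using congrFun hx 0
    rw [← Fin.cons_self_tail x, hx0, hmulVec] at hx
    exact ⟨Fin.tail x, (Fin.cons_inj.1 hx).2⟩
  exact ⟨AffineEquiv.ofBijective ⟨hinj, hsurj⟩, by rw [← hf, h1]; rfl⟩

end Representation

section ConjBlockAlgebra

variable {n : ℕ}

/-- Conjugation `M ↦ P M P⁻¹` with `P = Φ(φ)`. -/
def conjPhi (φ : GA n) :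
    Matrix (Fin (n + 1)) (Fin (n + 1)) ℂ ≃ₐ[ℂ] Matrix (Fin (n + 1)) (Fin (n + 1)) ℂ :=
  MulSemiringAction.toAlgEquiv ℂ _ (ConjAct.toConjAct (PhiUnit φ))

/-- The algebra `P (𝕋_{n₁}(ℂ) ⊕ ⋯ ⊕ 𝕋_{n_r}(ℂ)) P⁻¹` with `P = Φ(φ)`. -/
def conjBlockSubalgebra (η : Composition (n + 1)) (φ : GA n) :
    Subalgebra ℂ (Matrix (Fin (n + 1)) (Fin (n + 1)) ℂ) :=
  (blockSubalgebra η).map (conjPhi φ).toAlgHom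

variable {η : Composition (n + 1)} {φ : GA n} {B C : Matrix (Fin (n + 1)) (Fin (n + 1)) ℂ}

lemma conjPhi_apply : conjPhi φ B = Phi (φ : MA n) * B * (Phi (φ : MA n))⁻¹ := by
  rw [← show (PhiUnit φ : Matrix _ _ ℂ) = Phi (φ : MA n) from rfl, ← Matrix.coe_units_inv]
  rfl

lemma conjPhi_symm_apply : (conjPhi φ).symm B = (Phi (φ : MA n))⁻¹ * B * Phi (φ : MA n) := by
  rw [← show (PhiUnit φ : Matrix _ _ ℂ) = Phi (φ : MA n) from rfl, ← Matrix.coe_units_inv]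
  rfl

lemma mem_conjBlockSubalgebra_iff : B ∈ conjBlockSubalgebra η φ ↔
    (Phi (φ : MA n))⁻¹ * B * Phi (φ : MA n) ∈ blockAlgebra η := by
  rw [← conjPhi_symm_apply]
  exact ⟨by rintro ⟨K, hK, rfl⟩; simpa using show K ∈ blockAlgebra η from hK,
    fun h ↦ ⟨_, h, by simp⟩⟩

lemma conjBlockSubalgebra_le : conjBlockSubalgebra η φ ≤ cornerSubalgebra n := by
  rintro _ ⟨K, hK, rfl⟩
  exact mul_mem (mul_mem (blockMatrix_mem_cornerSubalgebra _ _) fun j ↦ hK.2.1 _ _ j.succ_pos)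
    (blockMatrix_mem_cornerSubalgebra _ _)

lemma commute_of_commute_exp_of_mem_conjBlockSubalgebra (hB : B ∈ conjBlockSubalgebra η φ)
    (hC : C ∈ conjBlockSubalgebra η φ) (h : Commute (exp B) C) : Commute B C := by
  obtain ⟨B, hB, rfl⟩ := hB
  obtain ⟨C, hC, rfl⟩ := hC
  have hexp : exp (conjPhi φ B) = conjPhi φ (exp B) :=
    (map_exp_complex (conjPhi φ).toAlgHom
      (conjPhi φ).toLinearMap.continuous_of_finiteDimensional B).symm
  have hcomm : Commute (conjPhi φ (exp B)) (conjPhi φ C) := hexp ▸ h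
  exact (commute_of_commute_exp_of_mem_blockSubalgebra hB hC
    (hcomm.of_map (conjPhi φ).injective)).map (conjPhi φ)

lemma cons_w₀ : (Fin.cons 1 (w₀ η φ) : Fin (n + 1) → ℂ) = Phi (φ : MA n) *ᵥ u₀ η := by
  have h0 : (Phi (φ : MA n) *ᵥ u₀ η) 0 = 1 := by
    rw [Phi, mulVec_apply_zero (blockMatrix_mem_cornerSubalgebra 1 _)]
    simp [blockMatrix, u₀]
  rw [w₀, ← h0, Fin.cons_self_tail]

lemma isUnit_of_mulVec_eq_cons_w₀ (hB : B ∈ conjBlockSubalgebra η φ) {x : Fin (n + 1) → ℂ}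
    (hx : B *ᵥ x = Fin.cons 1 (w₀ η φ)) : IsUnit B := by
  obtain ⟨K, hK, rfl⟩ := hB
  refine IsUnit.map (conjPhi φ) (isUnit_of_mulVec_eq_u₀ hK (x := (Phi (φ : MA n))⁻¹ *ᵥ x) ?_)
  refine Matrix.mulVec_injective_of_isUnit (show IsUnit (Phi (φ : MA n)) from (PhiUnit φ).isUnit) ?_
  change conjPhi φ K *ᵥ x = _ at hx
  rw [conjPhi_apply, cons_w₀] at hx
  simpa [Matrix.mulVec_mulVec, mul_assoc] using hx

end ConjBlockAlgebra

section Density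

variable {n : ℕ} {A : Subalgebra ℂ (Matrix (Fin (n + 1)) (Fin (n + 1)) ℂ)} {w : Fin n → ℂ}

/-- Evaluation of the matrices of `A` at the vector `(1, w)`. -/
def evalCons (A : Subalgebra ℂ (Matrix (Fin (n + 1)) (Fin (n + 1)) ℂ)) (w : Fin n → ℂ) :
    A →ₗ[ℂ] (Fin (n + 1) → ℂ) :=
  (Matrix.mulVecBilin ℂ ℂ).flip (Fin.cons 1 w) ∘ₗ A.val.toLinearMap

lemma evalCons_apply (a : A) : evalCons A w a = a.1 *ᵥ Fin.cons 1 w := rfl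

lemma evalCons_surjective_of_dense {S : Set (MA n)} {c : ℂ} (hS : ∀ f ∈ S, blockMatrix c f ∈ A)
    (hd : Dense (orbit S w)) : Function.Surjective (evalCons A w) := by
  refine LinearMap.range_eq_top.1 (eq_top_of_cons_mem (c := c) (w := w) (fun x ↦ ?_) ?_)
  · have hcont : Continuous fun x : Fin n → ℂ ↦ (Fin.cons c x : Fin (n + 1) → ℂ) := by fun_prop
    have hclosed := (evalCons A w).range.closed_of_finiteDimensional.preimage hcont
    refine (hclosed.closure_subset_iff.2 ?_) (hd x)
    rintro _ ⟨f, hf, rfl⟩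
    exact ⟨⟨_, hS f hf⟩, blockMatrix_mulVec_cons c f w⟩
  · exact ⟨1, Matrix.one_mulVec _⟩

lemma evalCons_injective [IsMulCommutative A] (hw : Function.Surjective (evalCons A w)) :
    Function.Injective (evalCons A w) := by
  refine (injective_iff_map_eq_zero _).2 fun a ha ↦ Subtype.ext ?_
  refine Matrix.ext_of_mulVec_single fun i ↦ ?_
  obtain ⟨b, hb⟩ := hw (Pi.single i 1)
  rw [evalCons_apply] at ha hb
  have hab : a.1 * b.1 = b.1 * a.1 := congrArg Subtype.val (mul_comm' a b)
  rw [← hb, Matrix.mulVec_mulVec, hab, ← Matrix.mulVec_mulVec, ha]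
  simp

variable (hA : A ≤ cornerSubalgebra n)

/-- The character `[c 0; a A] ↦ c` of an algebra of such matrices. -/
def corner : A →ₐ[ℂ] ℂ := (cornerCharacter n).comp (Subalgebra.inclusion hA)

variable {hA}

lemma evalCons_apply_zero (a : A) : evalCons A w a 0 = corner hA a := by
  rw [evalCons_apply, mulVec_apply_zero (hA a.2), Fin.cons_zero, mul_one]
  rfl

/-- If `(1, w)` is a cyclic vector of the commutative algebra `A`, then evaluation at `(1, w)`
identifies the matrices `[c 0; a A]` of `A` with a given `c` with `{c} × ℂⁿ`, hence with `ℂⁿ`. -/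
noncomputable def evalSlice [IsMulCommutative A] (hw : Function.Surjective (evalCons A w)) (c : ℂ) :
    {a : A // corner hA a = c} ≃ₜ (Fin n → ℂ) :=
  have : IsTopologicalAddGroup A := inferInstanceAs (IsTopologicalAddGroup A.toSubmodule)
  let e := (LinearEquiv.ofBijective (evalCons A w) ⟨evalCons_injective hw, hw⟩)
    |>.toContinuousLinearEquiv
  { toFun a := Fin.tail (e a)
    invFun y := ⟨e.symm (Fin.cons c y), by
      rw [← evalCons_apply_zero (w := w)]
      exact congrFun (e.apply_symm_apply _) 0⟩
    left_inv a := by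
      have h0 : e a 0 = c := (evalCons_apply_zero _).trans a.2
      ext1
      simp only [← h0, Fin.cons_self_tail, ContinuousLinearEquiv.symm_apply_apply]
    right_inv y := by simp
    continuous_toFun := by unfold Fin.tail; fun_prop
    continuous_invFun := by fun_prop }

section

variable [IsMulCommutative A] (hw : Function.Surjective (evalCons A w))

lemma evalSlice_mem_orbit_iff {S : Set (MA n)} {c : ℂ} (hS : ∀ f ∈ S, blockMatrix c f ∈ A)
    (a : {a : A // corner hA a = c}) :
    evalSlice hw c a ∈ orbit S w ↔ (a : Matrix _ _ ℂ) ∈ blockMatrix c '' S := by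
  have hcons : Fin.cons c (evalSlice hw c a) = evalCons A w a := by
    nth_rw 1 [← a.2]
    rw [← evalCons_apply_zero (w := w)]
    exact Fin.cons_self_tail _
  refine exists_congr fun f ↦ and_congr_right fun hf ↦ ?_
  calc f w = evalSlice hw c a
      ↔ (Fin.cons c (f w) : Fin (n + 1) → ℂ) = Fin.cons c (evalSlice hw c a) := by simp
    _ ↔ evalCons A w ⟨_, hS f hf⟩ = evalCons A w a := by
      rw [hcons, evalCons_apply ⟨_, hS f hf⟩, blockMatrix_mulVec_cons]
    _ ↔ _ := (evalCons_injective hw).eq_iff.trans Subtype.ext_iff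

include hw in
lemma dense_orbit_iff {S : Set (MA n)} {c : ℂ} (hS : ∀ f ∈ S, blockMatrix c f ∈ A) :
    Dense (orbit S w) ↔
      Dense {a : {a : A // corner hA a = c} | (a : Matrix _ _ ℂ) ∈ blockMatrix c '' S} := by
  rw [← dense_preimage_iff (evalSlice (hA := hA) hw c).continuous (evalSlice hw c).isOpenMap
    (evalSlice hw c).surjective.denseRange]
  exact iff_of_eq (congrArg Dense (Set.ext (evalSlice_mem_orbit_iff hw hS)))

end

theorem dense_orbit_exp_iff [IsMulCommutative A] (hA : A ≤ cornerSubalgebra n) {S T : Set (MA n)}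
    (hS : ∀ f ∈ S, Phi f ∈ A) (hT : ∀ f, f ∈ T ↔ Psi f ∈ A ∧ exp (Psi f) ∈ Phi '' S) :
    Dense (orbit T w) ↔ Dense (orbit S w) := by
  have hT' (f) (hf : f ∈ T) : blockMatrix 0 f ∈ A := ((hT f).1 hf).1
  have key (hw : Function.Surjective (evalCons A w)) :
      Dense (orbit T w) ↔ Dense (orbit S w) := by
    rw [dense_orbit_iff (hA := hA) hw hT', dense_orbit_iff (hA := hA) hw hS]
    refine Iff.trans (iff_of_eq (congrArg Dense (Set.ext fun a ↦ ?_)))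
      (dense_preimage_iff (continuous_expKer (corner hA)) (isOpenMap_expKer _)
        (denseRange_expKer _))
    have hexp : (expKer _ a).1.1 = exp a.1.1 := coe_exp_subalgebra a.1
    simp only [Set.mem_ofPred_eq, Set.mem_preimage, hexp]
    obtain ⟨f, hf⟩ := exists_blockMatrix_eq (hA a.1.2)
    have hPsi : Psi f = a.1 := by rw [← hf]; exact congrArg (blockMatrix · f) a.2.symm
    constructor
    · rintro ⟨g, hg, hga⟩
      exact hga ▸ ((hT g).1 hg).2
    · exact fun h ↦ ⟨f, (hT f).2 ⟨hPsi ▸ a.1.2, hPsi ▸ h⟩, hPsi⟩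
  exact ⟨fun h ↦ (key (evalCons_surjective_of_dense hT' h)).1 h,
    fun h ↦ (key (evalCons_surjective_of_dense hS h)).2 h⟩

end Density

section Equivalences

variable {n : ℕ} {𝒢 : Subsemigroup (MA n)} {η : Composition (n + 1)} {φ : GA n} {f g : MA n}

lemma mem_affineLogs : f ∈ affineLogs 𝒢 η φ ↔
    exp (Psi f) ∈ Phi '' (𝒢 : Set (MA n)) ∧ Psi f ∈ conjBlockSubalgebra η φ := by
  have himage : (fun M ↦ Phi (φ : MA n) * M * (Phi (φ : MA n))⁻¹) '' blockAlgebra η =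
      conjBlockSubalgebra η φ := by
    simp_rw [← conjPhi_apply]
    rfl
  simp [affineLogs, logs, himage]

/-- The algebra generated by `Φ(𝒢)` and `Ψ(𝔮)`. -/
def logAlgebra (𝒢 : Subsemigroup (MA n)) (η : Composition (n + 1)) (φ : GA n) :
    Subalgebra ℂ (Matrix (Fin (n + 1)) (Fin (n + 1)) ℂ) :=
  Algebra.adjoin ℂ (Phi '' 𝒢 ∪ Psi '' affineLogs 𝒢 η φ)

lemma Phi_mem_logAlgebra (hf : f ∈ 𝒢) : Phi f ∈ logAlgebra 𝒢 η φ :=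
  Algebra.subset_adjoin (.inl ⟨f, hf, rfl⟩)

lemma Psi_mem_logAlgebra (hf : f ∈ affineLogs 𝒢 η φ) : Psi f ∈ logAlgebra 𝒢 η φ :=
  Algebra.subset_adjoin (.inr ⟨f, hf, rfl⟩)

variable (hnf : IsNormalForm 𝒢 η φ)

include hnf in
lemma logAlgebra_le : logAlgebra 𝒢 η φ ≤ conjBlockSubalgebra η φ := by
  refine Algebra.adjoin_le (Set.union_subset ?_ ?_)
  · rintro _ ⟨f, hf, rfl⟩
    exact mem_conjBlockSubalgebra_iff.2 (hnf f hf)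
  · rintro _ ⟨f, hf, rfl⟩
    exact (mem_affineLogs.1 hf).2

variable (hab : ∀ f ∈ 𝒢, ∀ g ∈ 𝒢, f * g = g * f)

include hab

lemma commute_Phi (hf : f ∈ 𝒢) (hg : g ∈ 𝒢) : Commute (Phi f) (Phi g) := by
  rw [Commute, SemiconjBy, ← Phi_mul, ← Phi_mul, hab f hf g hg]

include hnf

lemma commute_Psi_Phi (hf : f ∈ affineLogs 𝒢 η φ) (hg : g ∈ 𝒢) : Commute (Psi f) (Phi g) := by
  obtain ⟨⟨f', hf', hexp⟩, hf⟩ := mem_affineLogs.1 hf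
  exact commute_of_commute_exp_of_mem_conjBlockSubalgebra hf
    (mem_conjBlockSubalgebra_iff.2 (hnf g hg)) (hexp ▸ commute_Phi hab hf' hg)

lemma commute_Psi (hf : f ∈ affineLogs 𝒢 η φ) (hg : g ∈ affineLogs 𝒢 η φ) :
    Commute (Psi f) (Psi g) := by
  obtain ⟨⟨f', hf', hexp⟩, hfB⟩ := mem_affineLogs.1 hf
  exact commute_of_commute_exp_of_mem_conjBlockSubalgebra hfB (mem_affineLogs.1 hg).2
    (hexp ▸ (commute_Psi_Phi hnf hab hg hf').symm)

lemma isMulCommutative_logAlgebra : IsMulCommutative (logAlgebra 𝒢 η φ) := by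
  refine Algebra.isMulCommutative_adjoin ℂ ?_
  rintro _ (⟨f, hf, rfl⟩ | ⟨f, hf, rfl⟩) _ (⟨g, hg, rfl⟩ | ⟨g, hg, rfl⟩)
  · exact commute_Phi hab hf hg
  · exact (commute_Psi_Phi hnf hab hg hf).symm
  · exact commute_Psi_Phi hnf hab hf hg
  · exact commute_Psi hnf hab hf hg

lemma exists_addSubsemigroup_eq_orbit (w : Fin n → ℂ) : ∃ Q : AddSubsemigroup (Fin n → ℂ),
    (Q : Set (Fin n → ℂ)) = orbit (affineLogs 𝒢 η φ) w := by
  refine ⟨⟨orbit (affineLogs 𝒢 η φ) w, ?_⟩, rfl⟩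
  rintro _ _ ⟨f, hf, rfl⟩ ⟨g, hg, rfl⟩
  refine ⟨f + g, mem_affineLogs.2 ?_, rfl⟩
  obtain ⟨⟨f', hf', hexpf⟩, hfB⟩ := mem_affineLogs.1 hf
  obtain ⟨⟨g', hg', hexpg⟩, hgB⟩ := mem_affineLogs.1 hg
  rw [Psi_add, Matrix.exp_add_of_commute _ _ (commute_Psi hnf hab hf hg), ← hexpf, ← hexpg,
    ← Phi_mul]
  exact ⟨⟨f' * g', 𝒢.mul_mem hf' hg', rfl⟩, add_mem hfB hgB⟩

lemma dense_orbit_affineLogs_iff {w : Fin n → ℂ} :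
    Dense (orbit (affineLogs 𝒢 η φ) w) ↔ Dense (orbit (𝒢 : Set (MA n)) w) := by
  have := isMulCommutative_logAlgebra hnf hab
  have hle := logAlgebra_le hnf
  refine dense_orbit_exp_iff (A := logAlgebra 𝒢 η φ) (hle.trans conjBlockSubalgebra_le)
    (fun f ↦ Phi_mem_logAlgebra) fun f ↦ ⟨fun hf ↦ ⟨Psi_mem_logAlgebra hf, ?_⟩, fun hf ↦ ?_⟩
  · exact (mem_affineLogs.1 hf).1
  · exact mem_affineLogs.2 ⟨hf.2, hle hf.1⟩

lemma exists_affineEquiv_commute_apply_eq_w₀ {x : Fin n → ℂ}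
    (hx : Dense (orbit (𝒢 : Set (MA n)) x)) :
    ∃ β : GA n, β x = w₀ η φ ∧ ∀ f ∈ 𝒢, ∀ y, β (f y) = f (β y) := by
  have := isMulCommutative_logAlgebra hnf hab
  obtain ⟨a, ha⟩ := evalCons_surjective_of_dense (A := logAlgebra 𝒢 η φ) (c := 1)
    (fun f ↦ Phi_mem_logAlgebra) hx (Fin.cons 1 (w₀ η φ))
  have haB : a.1 ∈ conjBlockSubalgebra η φ := logAlgebra_le hnf a.2
  have hcorner : a.1 ∈ cornerSubalgebra n := conjBlockSubalgebra_le haB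
  have ha00 : a.1 0 0 = 1 := by
    simpa [evalCons_apply, mulVec_apply_zero hcorner] using congrFun ha 0
  obtain ⟨β, hβ⟩ := exists_PhiUnit_eq hcorner ha00 (isUnit_of_mulVec_eq_cons_w₀ haB ha)
  have hmulVec (y : Fin n → ℂ) : a.1 *ᵥ Fin.cons 1 y = Fin.cons 1 (β y) := by
    rw [← hβ]
    exact Phi_mulVec _ y
  refine ⟨β, (Fin.cons_inj.1 ((hmulVec x).symm.trans ha)).2, fun f hf y ↦ ?_⟩
  have hcomm : a.1 * Phi f = Phi f * a.1 :=
    congrArg Subtype.val (mul_comm' a ⟨Phi f, Phi_mem_logAlgebra hf⟩)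
  have hvec := congrArg (· *ᵥ (Fin.cons 1 y : Fin (n + 1) → ℂ)) hcomm
  simp only [← Matrix.mulVec_mulVec, Phi_mulVec, hmulVec] at hvec
  exact (Fin.cons_inj.1 hvec).2

lemma dense_orbit_w₀ (h : IsHypercyclic 𝒢) : Dense (orbit (𝒢 : Set (MA n)) (w₀ η φ)) := by
  obtain ⟨x, hx⟩ := h
  obtain ⟨β, hβx, hβ⟩ := exists_affineEquiv_commute_apply_eq_w₀ (φ := φ) hnf hab hx
  have hcont : Continuous β := (β : MA n).continuous_of_finiteDimensional
  refine (β.surjective.denseRange.dense_image hcont hx).mono ?_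
  rintro _ ⟨_, ⟨f, hf, rfl⟩, rfl⟩
  exact ⟨f, hf, by rw [hβ f hf, hβx]⟩

theorem tfae_of_isNormalForm : List.TFAE [
    IsHypercyclic 𝒢,
    Dense (orbit (𝒢 : Set (MA n)) (w₀ η φ)),
    (∃ Q : AddSubsemigroup (Fin n → ℂ),
      (Q : Set (Fin n → ℂ)) = orbit (affineLogs 𝒢 η φ) (w₀ η φ)) ∧
      Dense (orbit (affineLogs 𝒢 η φ) (w₀ η φ))] := by
  tfae_have 1 → 2 := dense_orbit_w₀ hnf hab
  tfae_have 2 → 1 := fun h ↦ ⟨_, h⟩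
  tfae_have 2 → 3 := fun h ↦
    ⟨exists_addSubsemigroup_eq_orbit hnf hab _, (dense_orbit_affineLogs_iff hnf hab).2 h⟩
  tfae_have 3 → 2 := fun h ↦ (dense_orbit_affineLogs_iff hnf hab).1 h.2
  tfae_finish

end Equivalences

section LowerBasis

variable {K V ι : Type*} [Field K] [AddCommGroup V] [Module K V]
  {f : ι → End K V} {χ : ι → K} {H W : Submodule K V}

/-- `b` is a basis of `W` in which every `f i` is lower triangular with constant diagonal `χ i`. -/
structure IsLowerBasis (f : ι → End K V) (χ : ι → K) (W : Submodule K V) {d : ℕ}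
    (b : Fin d → V) : Prop where
  linearIndependent : LinearIndependent K b
  span_eq : Submodule.span K (Set.range b) = W
  sub_mem (i : ι) (j : Fin d) : f i (b j) - χ i • b j ∈ Submodule.span K (b '' Set.Ioi j)

namespace IsLowerBasis

variable {d : ℕ} {b : Fin d → V}

lemma mem (hb : IsLowerBasis f χ W b) (j : Fin d) : b j ∈ W :=
  hb.span_eq ▸ Submodule.subset_span ⟨j, rfl⟩

lemma finrank_eq (hb : IsLowerBasis f χ W b) : finrank K W = d := by
  rw [← hb.span_eq, finrank_span_eq_card hb.linearIndependent, Fintype.card_fin]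

lemma cons (hb : IsLowerBasis f χ H b) {y : V} (hyH : y ∉ H) (hW : H ⊔ K ∙ y = W)
    (hy : ∀ i, f i y - χ i • y ∈ H) : IsLowerBasis f χ W (Fin.cons y b : Fin (d + 1) → V) where
  linearIndependent := linearIndependent_finCons.2 ⟨hb.linearIndependent, hb.span_eq ▸ hyH⟩
  span_eq := by rw [Fin.range_cons, Submodule.span_insert, hb.span_eq, sup_comm, hW]
  sub_mem i j := by
    cases j using Fin.cases with
    | zero =>
      rw [Fin.cons_zero]
      refine Submodule.span_mono ?_ (hb.span_eq.symm ▸ hy i)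
      rintro _ ⟨l, rfl⟩
      exact ⟨l.succ, l.succ_pos, rfl⟩
    | succ j =>
      rw [Fin.cons_succ]
      refine Submodule.span_mono ?_ (hb.sub_mem i j)
      rintro _ ⟨l, hl, rfl⟩
      exact ⟨l.succ, Fin.succ_lt_succ_iff.2 hl, rfl⟩

end IsLowerBasis

lemma sup_map_ne_of_le_ker_pow {T : End K V} (hHW : H < W) (hH : H.map T ≤ H) {k : ℕ}
    (hk : W ≤ LinearMap.ker (T ^ k)) : H ⊔ W.map T ≠ W := by
  intro heq
  have hpow (k : ℕ) : W ≤ H ⊔ W.map (T ^ k) := by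
    induction k with
    | zero => exact le_sup_of_le_right (W.map_id).ge
    | succ k ih =>
      calc W = H ⊔ W.map T := heq.symm
        _ ≤ H ⊔ (H ⊔ W.map (T ^ k)).map T := by gcongr
        _ ≤ H ⊔ W.map (T ^ (k + 1)) := by
          rw [Submodule.map_sup, ← Submodule.map_comp, pow_succ']
          exact sup_le le_sup_left (sup_le_sup_right hH _)
  have hmap : W.map (T ^ k) = ⊥ := le_bot_iff.1 (Submodule.map_le_iff_le_comap.2 hk)
  exact hHW.not_ge (by simpa [hmap] using hpow k)

/-- The lattice of the subspaces invariant under all `f i`. -/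
def invtLattice (f : ι → End K V) : Sublattice (Submodule K V) := ⨅ i, (f i).invtSubmodule

lemma mem_invtLattice : W ∈ invtLattice f ↔ ∀ i, ∀ x ∈ W, f i x ∈ W := by
  simp only [invtLattice, Sublattice.mem_iInf]
  rfl

/-- The simultaneous generalized eigenspace of the `f i` with eigenvalues `χ i`. -/
def weightSpace (f : ι → End K V) (χ : ι → K) : Submodule K V :=
  ⨅ i, (f i).maxGenEigenspace (χ i)

variable [FiniteDimensional K V]

lemma weightSpace_le_ker_pow (i : ι) : weightSpace f χ ≤
    LinearMap.ker ((f i - algebraMap K (End K V) (χ i)) ^ finrank K V) := by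
  refine (iInf_le _ i).trans ?_
  rw [End.maxGenEigenspace_eq_genEigenspace_finrank]
  exact fun x ↦ End.mem_genEigenspace_nat.1

lemma sub_smul_mem_of_covBy (hcomm : ∀ i j, Commute (f i) (f j)) {H W : invtLattice f}
    (hHW : H ⋖ W) (hχ : W.1 ≤ weightSpace f χ) (i : ι) {x : V} (hx : x ∈ W.1) :
    f i x - χ i • x ∈ H.1 := by
  set T : End K V := f i - algebraMap K (End K V) (χ i)
  have hTapply (x : V) : T x = f i x - χ i • x := by simp [T, Module.algebraMap_end_apply]
  have hmap (L : invtLattice f) : L.1.map T ≤ L.1 := by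
    rintro _ ⟨z, hz, rfl⟩
    exact hTapply z ▸ L.1.sub_mem (mem_invtLattice.1 L.2 i z hz) (L.1.smul_mem _ hz)
  have hTcomm (j : ι) : Commute (f j) T :=
    (hcomm j i).sub_right (Algebra.commute_algebraMap_right _ _)
  let TW : invtLattice f := ⟨W.1.map T, mem_invtLattice.2 <| by
    rintro j _ ⟨z, hz, rfl⟩
    exact ⟨f j z, mem_invtLattice.1 W.2 j z hz, (LinearMap.congr_fun (hTcomm j).eq z).symm⟩⟩
  have hne : H ⊔ TW ≠ W := fun h ↦ sup_map_ne_of_le_ker_pow hHW.lt (hmap H)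
    (hχ.trans (weightSpace_le_ker_pow i)) (congrArg Subtype.val h)
  have hsup : H ⊔ TW = H :=
    (hHW.eq_or_eq le_sup_left (sup_le hHW.le (hmap W))).resolve_right hne
  have hTW : TW ≤ H := sup_eq_left.1 hsup
  exact hTapply x ▸ hTW ⟨x, hx, rfl⟩

lemma exists_isLowerBasis (hcomm : ∀ i j, Commute (f i) (f j)) (W : invtLattice f)
    (hχ : W.1 ≤ weightSpace f χ) : ∃ (d : ℕ) (b : Fin d → V), IsLowerBasis f χ W.1 b := by
  induction W using WellFoundedLT.induction with
  | ind W ih =>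
  by_cases hmin : IsMin W
  · let bot : invtLattice f := ⟨⊥, mem_invtLattice.2 (by simp)⟩
    have hbot : W.1 = ⊥ := le_bot_iff.1 (hmin (show bot ≤ W from bot_le (a := W.1)))
    exact ⟨0, Fin.elim0, linearIndependent_empty_type, by simp [hbot], fun _ j ↦ j.elim0⟩
  obtain ⟨H, hHW⟩ := exists_covBy_of_wellFoundedGT hmin
  have hlt : H.1 < W.1 := hHW.lt
  obtain ⟨y, hyW, hyH⟩ := SetLike.exists_of_lt hlt
  have hsub (i : ι) {x : V} (hx : x ∈ W.1) := sub_smul_mem_of_covBy hcomm hHW hχ i hx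
  have hle : H.1 ⊔ K ∙ y ≤ W.1 := sup_le hlt.le (by simpa using hyW)
  let L : invtLattice f := ⟨H.1 ⊔ K ∙ y, mem_invtLattice.2 fun i x hx ↦ by
    rw [← sub_add_cancel (f i x) (χ i • x)]
    exact add_mem (Submodule.mem_sup_left (hsub i (hle hx))) (Submodule.smul_mem _ _ hx)⟩
  have hyL : y ∈ L.1 := Submodule.mem_sup_right (Submodule.mem_span_singleton_self y)
  have hHL : H.1 ≤ L.1 := le_sup_left
  have hL : L = W := (hHW.eq_or_eq hHL hle).resolve_left fun h ↦ hyH (h ▸ hyL)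
  obtain ⟨d, b, hb⟩ := ih H hlt (hlt.le.trans hχ)
  exact ⟨d + 1, Fin.cons y b, hb.cons hyH (congrArg Subtype.val hL) fun i ↦ hsub i hyW⟩

end LowerBasis

section Weights

variable {K V ι : Type*} [Field K] [AddCommGroup V] [Module K V]
  {f : ι → End K V} {χ ψ : ι → K} {ℓ : V →ₗ[K] K}

lemma weightSpace_mem_invtLattice (hcomm : ∀ i j, Commute (f i) (f j)) (χ : ι → K) :
    weightSpace f χ ∈ invtLattice f := by
  refine mem_invtLattice.2 fun i x hx ↦ ?_
  rw [weightSpace, Submodule.mem_iInf] at hx ⊢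
  exact fun j ↦ End.mapsTo_maxGenEigenspace_of_comm (hcomm j i) (χ j) (hx j)

lemma sup_span_singleton_eq_of_apply_eq_one {W : Submodule K V} {y : V} (hyW : y ∈ W)
    (hy : ℓ y = 1) : W ⊓ LinearMap.ker ℓ ⊔ K ∙ y = W := by
  refine le_antisymm (sup_le inf_le_left (by simpa using hyW)) fun x hx ↦ ?_
  rw [← sub_add_cancel x (ℓ x • y)]
  exact add_mem (Submodule.mem_sup_left ⟨sub_mem hx (W.smul_mem _ hyW), by simp [hy]⟩)
    (Submodule.mem_sup_right (Submodule.smul_mem _ _ (Submodule.mem_span_singleton_self y)))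

variable [FiniteDimensional K V]

lemma isInternal_weightSpace [IsAlgClosed K] [DecidableEq (ι → K)]
    (hcomm : ∀ i j, Commute (f i) (f j)) : DirectSum.IsInternal (weightSpace f) :=
  DirectSum.isInternal_submodule_of_iSupIndep_of_iSup_eq_top
    (End.independent_iInf_maxGenEigenspace_of_forall_mapsTo f
      fun i j φ ↦ End.mapsTo_maxGenEigenspace_of_comm (hcomm j i) φ)
    (End.iSup_iInf_maxGenEigenspace_eq_top_of_iSup_maxGenEigenspace_eq_top_of_commute f
      (fun i j _ ↦ hcomm i j) fun i ↦ End.iSup_maxGenEigenspace_eq_top (f i))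

lemma apply_eq_zero_of_mem_weightSpace (hℓ : ∀ i x, ℓ (f i x) = ψ i * ℓ x) (hχ : χ ≠ ψ) {x : V}
    (hx : x ∈ weightSpace f χ) : ℓ x = 0 := by
  obtain ⟨i, hi⟩ := Function.ne_iff.1 hχ
  have hpow (k : ℕ) :
      ℓ (((f i - algebraMap K (End K V) (χ i)) ^ k) x) = (ψ i - χ i) ^ k * ℓ x := by
    induction k with
    | zero => simp
    | succ k ih =>
      rw [pow_succ', End.mul_apply, LinearMap.sub_apply, map_sub, hℓ,
        Module.algebraMap_end_apply, map_smul, ih, smul_eq_mul]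
      ring
  have hzero := hpow (finrank K V)
  rw [weightSpace_le_ker_pow i hx, map_zero] at hzero
  exact (mul_eq_zero.1 hzero.symm).resolve_left (pow_ne_zero _ (sub_ne_zero.2 hi.symm))

lemma exists_mem_weightSpace_apply_eq_one (htop : ⨆ χ, weightSpace f χ = ⊤)
    (hℓ : ∀ i x, ℓ (f i x) = ψ i * ℓ x) (hℓ0 : ℓ ≠ 0) : ∃ y ∈ weightSpace f ψ, ℓ y = 1 := by
  obtain ⟨x, hx, hℓx⟩ : ∃ x ∈ weightSpace f ψ, ℓ x ≠ 0 := by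
    by_contra! hzero
    refine hℓ0 (LinearMap.ker_eq_top.1 (eq_top_iff.2 (htop ▸ iSup_le fun χ x hx ↦ ?_)))
    by_cases hχ : χ = ψ
    · exact hzero x (hχ ▸ hx)
    · exact apply_eq_zero_of_mem_weightSpace hℓ hχ hx
  exact ⟨(ℓ x)⁻¹ • x, Submodule.smul_mem _ _ hx, by simp [hℓx]⟩

lemma exists_isLowerBasis_weightSpace_apply_eq (hcomm : ∀ i j, Commute (f i) (f j))
    (hℓ : ∀ i x, ℓ (f i x) = ψ i * ℓ x) {y : V} (hyW : y ∈ weightSpace f ψ) (hy : ℓ y = 1) :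
    ∃ (d : ℕ) (b : Fin d → V), IsLowerBasis f ψ (weightSpace f ψ) b ∧
      ∀ j : Fin d, ℓ (b j) = if (j : ℕ) = 0 then 1 else 0 := by
  have hinv := mem_invtLattice.1 (weightSpace_mem_invtLattice hcomm ψ)
  let H : invtLattice f := ⟨weightSpace f ψ ⊓ LinearMap.ker ℓ, mem_invtLattice.2 fun i x hx ↦
    ⟨hinv i x hx.1, by simp [hℓ, LinearMap.mem_ker.1 hx.2]⟩⟩
  obtain ⟨d, b, hb⟩ := exists_isLowerBasis hcomm H inf_le_left
  refine ⟨d + 1, Fin.cons y b, hb.cons (fun h ↦ ?_)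
    (sup_span_singleton_eq_of_apply_eq_one hyW hy) fun i ↦ ?_, fun j ↦ ?_⟩
  · exact one_ne_zero (hy.symm.trans h.2)
  · exact ⟨sub_mem (hinv i y hyW) (Submodule.smul_mem _ _ hyW), by simp [hℓ, hy]⟩
  · cases j using Fin.cases with
    | zero => simpa using hy
    | succ j => simpa using (hb.mem j).2

lemma exists_isLowerBasis_weightSpace [DecidableEq (ι → K)] (hcomm : ∀ i j, Commute (f i) (f j))
    (htop : ⨆ χ, weightSpace f χ = ⊤) (hℓ : ∀ i x, ℓ (f i x) = ψ i * ℓ x) (hℓ0 : ℓ ≠ 0)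
    {d : ℕ} (hd : finrank K (weightSpace f χ) = d) :
    ∃ b : Fin d → V, IsLowerBasis f χ (weightSpace f χ) b ∧
      ∀ j : Fin d, ℓ (b j) = if χ = ψ ∧ (j : ℕ) = 0 then 1 else 0 := by
  suffices h : ∃ (d : ℕ) (b : Fin d → V), IsLowerBasis f χ (weightSpace f χ) b ∧
      ∀ j : Fin d, ℓ (b j) = if χ = ψ ∧ (j : ℕ) = 0 then 1 else 0 by
    obtain ⟨d', b, hb, hbℓ⟩ := h
    obtain rfl : d' = d := hb.finrank_eq.symm.trans hd
    exact ⟨b, hb, hbℓ⟩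
  by_cases hχ : χ = ψ
  · subst hχ
    obtain ⟨y, hyW, hy⟩ := exists_mem_weightSpace_apply_eq_one htop hℓ hℓ0
    simpa using exists_isLowerBasis_weightSpace_apply_eq hcomm hℓ hyW hy
  · obtain ⟨d, b, hb⟩ := exists_isLowerBasis hcomm
      ⟨weightSpace f χ, weightSpace_mem_invtLattice hcomm χ⟩ le_rfl
    refine ⟨d, b, hb, fun j ↦ ?_⟩
    rw [if_neg fun h ↦ hχ h.1]
    exact apply_eq_zero_of_mem_weightSpace hℓ hχ (hb.mem j)

end Weights

section Composition

lemma exists_composition_equiv {α : Type*} [Fintype α] (a₀ : α) {d : α → ℕ} (hd : ∀ a, 0 < d a)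
    {m : ℕ} (hsum : ∑ a, d a = m) : ∃ (c : Composition m) (e : Fin c.length ≃ α),
      (∀ k, c.blocksFun k = d (e k)) ∧ ∀ k, e k = a₀ ↔ (k : ℕ) = 0 := by
  classical
  have hpos : 0 < Fintype.card α := Fintype.card_pos_iff.2 ⟨a₀⟩
  let e : Fin (Fintype.card α) ≃ α :=
    (Equiv.swap ⟨0, hpos⟩ (Fintype.equivFin α a₀)).trans (Fintype.equivFin α).symm
  have he : e ⟨0, hpos⟩ = a₀ := by simp [e]
  let c : Composition m :=
    { blocks := List.ofFn (d ∘ e)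
      blocks_pos := fun hi ↦ by
        obtain ⟨k, rfl⟩ := (List.mem_ofFn' _ _).1 hi
        exact hd _
      blocks_sum := by rw [List.sum_ofFn, ← hsum]; exact e.sum_comp d }
  have hc : c.length = Fintype.card α := List.length_ofFn
  refine ⟨c, (finCongr hc).trans e, fun k ↦ List.get_ofFn (d ∘ e) k, fun k ↦ ?_⟩
  rw [← he, Equiv.trans_apply, e.apply_eq_iff_eq, Fin.ext_iff]
  rfl

lemma index_eq_zero_and_invEmbedding_eq_zero_iff {m : ℕ} (c : Composition (m + 1))
    (j : Fin (m + 1)) :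
    (c.index j : ℕ) = 0 ∧ (c.invEmbedding j : ℕ) = 0 ↔ j = 0 := by
  constructor
  · rintro ⟨hindex, hinv⟩
    rw [c.coe_invEmbedding, hindex, c.sizeUpTo_zero] at hinv
    exact Fin.ext hinv
  · rintro rfl
    have hsize : c.sizeUpTo (c.index 0) = 0 := Nat.le_zero.1 (c.sizeUpTo_index_le 0)
    refine ⟨?_, by simp⟩
    by_contra hne
    have hlt := c.sizeUpTo_strict_mono (i := 0) ((Nat.zero_le _).trans_lt (c.index 0).2)
    have hle : c.sizeUpTo (0 + 1) ≤ c.sizeUpTo (c.index 0) := c.monotone_sizeUpTo (by omega)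
    omega

end Composition

section BlockBasis

variable {V : Type*} [AddCommGroup V] [Module ℂ V] {m : ℕ} {c : Composition m}

lemma toMatrix_mem_blockAlgebra (B : Basis (Fin m) ℂ V) {g : End ℂ V} {a : Fin c.length → ℂ}
    (h : ∀ j, g (B j) - a (c.index j) • B j ∈
      Submodule.span ℂ (B '' {l | c.index l = c.index j ∧ j < l})) :
    LinearMap.toMatrix B B g ∈ blockAlgebra c := by
  have hentry (l j : Fin m) (hlj : ¬(c.index l = c.index j ∧ j < l)) :
      LinearMap.toMatrix B B g l j = if j = l then a (c.index j) else 0 := by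
    have hzero : B.repr (g (B j) - a (c.index j) • B j) l = 0 :=
      Finsupp.notMem_support_iff.1 fun hl ↦ hlj (B.mem_span_image.1 (h j) hl)
    rw [map_sub, map_smul, B.repr_self, Finsupp.sub_apply, Finsupp.smul_apply,
      Finsupp.single_apply, sub_eq_zero] at hzero
    rw [LinearMap.toMatrix_apply, hzero]
    simp
  refine ⟨fun l j hlj ↦ ?_, fun l j hlj ↦ ?_, fun l j hlj ↦ ?_⟩
  · rw [hentry l j fun h ↦ hlj h.1, if_neg fun h : j = l ↦ hlj (h ▸ rfl)]
  · rw [hentry l j fun h ↦ h.2.not_gt hlj, if_neg hlj.ne']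
  · rw [hentry l l fun h ↦ h.2.false, hentry j j fun h ↦ h.2.false, if_pos rfl, if_pos rfl, hlj]

variable {ι : Type*} {f : ι → End ℂ V} {W : Fin c.length → Submodule ℂ V}
  {χ : Fin c.length → ι → ℂ} {b : ∀ k, Fin (c.blocksFun k) → V}

lemma exists_basis_toMatrix_mem_blockAlgebra (hW : DirectSum.IsInternal W)
    (hb : ∀ k, IsLowerBasis f (χ k) (W k) (b k)) :
    ∃ B : Basis (Fin m) ℂ V, (∀ j, B j = b (c.index j) (c.invEmbedding j)) ∧
      ∀ i, LinearMap.toMatrix B B (f i) ∈ blockAlgebra c := by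
  let v (k : Fin c.length) : Basis (Fin (c.blocksFun k)) ℂ (W k) :=
    (Basis.span (hb k).linearIndependent).map (LinearEquiv.ofEq _ _ (hb k).span_eq)
  let B : Basis (Fin m) ℂ V := (hW.collectedBasis v).reindex c.blocksFinEquiv
  have hB_embedding (k : Fin c.length) (l : Fin (c.blocksFun k)) :
      B (c.embedding k l) = b k l := by
    change (hW.collectedBasis v).reindex c.blocksFinEquiv (c.blocksFinEquiv ⟨k, l⟩) = _
    rw [Basis.reindex_apply, Equiv.symm_apply_apply, hW.collectedBasis_coe]
    simp [v, Basis.span_apply]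
  have hB (j : Fin m) : B j = b (c.index j) (c.invEmbedding j) := by
    rw [← hB_embedding, c.embedding_comp_inv]
  refine ⟨B, hB, fun i ↦ toMatrix_mem_blockAlgebra B (a := (χ · i)) fun j ↦ ?_⟩
  rw [hB]
  refine Submodule.span_mono ?_ ((hb (c.index j)).sub_mem i (c.invEmbedding j))
  rintro _ ⟨l, hl, rfl⟩
  refine ⟨c.embedding (c.index j) l, ⟨c.index_embedding _ _, ?_⟩, hB_embedding _ _⟩
  conv_lhs => rw [← c.embedding_comp_inv j]
  exact (c.embedding (c.index j)).strictMono hl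

end BlockBasis

section NormalForm

theorem exists_composition_basis {V ι : Type*} [AddCommGroup V] [Module ℂ V]
    [FiniteDimensional ℂ V] {f : ι → End ℂ V} (hcomm : ∀ i j, Commute (f i) (f j)) {n : ℕ}
    (hV : finrank ℂ V = n + 1) {ℓ : V →ₗ[ℂ] ℂ} {ψ : ι → ℂ} (hℓ : ∀ i x, ℓ (f i x) = ψ i * ℓ x)
    (hℓ0 : ℓ ≠ 0) : ∃ (c : Composition (n + 1)) (B : Basis (Fin (n + 1)) ℂ V),
      (∀ i, LinearMap.toMatrix B B (f i) ∈ blockAlgebra c) ∧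
      ∀ j, ℓ (B j) = if j = 0 then 1 else 0 := by
  classical
  have hint : DirectSum.IsInternal (weightSpace f) := isInternal_weightSpace hcomm
  have htop := hint.submodule_iSup_eq_top
  let X := {χ : ι → ℂ // weightSpace f χ ≠ ⊥}
  have hintX : DirectSum.IsInternal fun χ : X ↦ weightSpace f χ :=
    DirectSum.isInternal_ne_bot_iff.2 hint
  have : Finite X := WellFoundedGT.finite_ne_bot_of_iSupIndep hint.submodule_iSupIndep
  have := Fintype.ofFinite X
  have hψ : weightSpace f ψ ≠ ⊥ := by
    obtain ⟨y, hyW, hy⟩ := exists_mem_weightSpace_apply_eq_one htop hℓ hℓ0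
    exact (Submodule.ne_bot_iff _).2 ⟨y, hyW, by rintro rfl; simp at hy⟩
  have hsum : ∑ χ : X, finrank ℂ (weightSpace f χ.1) = n + 1 := by
    rw [← hV, finrank_eq_card_basis (hintX.collectedBasis fun χ ↦ finBasis ℂ (weightSpace f χ.1))]
    simp
  obtain ⟨c, e, hce, he⟩ := exists_composition_equiv (⟨ψ, hψ⟩ : X)
    (fun χ ↦ Submodule.one_le_finrank_iff.2 χ.2) hsum
  choose b hb hbℓ using fun k ↦
    exists_isLowerBasis_weightSpace hcomm htop hℓ hℓ0 (χ := (e k).1) (hce k).symm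
  have hintc : DirectSum.IsInternal fun k ↦ weightSpace f (e k).1 :=
    DirectSum.isInternal_submodule_of_iSupIndep_of_iSup_eq_top
      (hintX.submodule_iSupIndep.comp e.injective)
      ((e.surjective.iSup_comp fun χ : X ↦ weightSpace f χ).trans hintX.submodule_iSup_eq_top)
  obtain ⟨B, hB, hBf⟩ := exists_basis_toMatrix_mem_blockAlgebra hintc hb
  refine ⟨c, B, hBf, fun j ↦ ?_⟩
  simp only [hB, hbℓ, ← index_eq_zero_and_invEmbedding_eq_zero_iff c j, ← he, Subtype.ext_iff]

theorem exists_isNormalForm {n : ℕ} (𝒢 : Subsemigroup (MA n))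
    (hab : ∀ f ∈ 𝒢, ∀ g ∈ 𝒢, f * g = g * f) :
    ∃ (η : Composition (n + 1)) (φ : GA n), IsNormalForm 𝒢 η φ := by
  let ℓ : (Fin (n + 1) → ℂ) →ₗ[ℂ] ℂ := LinearMap.proj 0
  have hcomm (f g : 𝒢) : Commute (Matrix.toLin' (Phi f.1)) (Matrix.toLin' (Phi g.1)) :=
    (commute_Phi hab f.2 g.2).map Matrix.toLinAlgEquiv'
  have hℓ (f : 𝒢) (x : Fin (n + 1) → ℂ) : ℓ (Matrix.toLin' (Phi f.1) x) = 1 * ℓ x :=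
    mulVec_apply_zero (blockMatrix_mem_cornerSubalgebra 1 f.1) x
  have hℓ0 : ℓ ≠ 0 := fun h ↦ by simpa [ℓ] using LinearMap.congr_fun h (Pi.single 0 1)
  obtain ⟨η, B, hB, hBℓ⟩ := exists_composition_basis hcomm (n := n) (by simp) (ψ := 1) hℓ hℓ0
  let s : Basis (Fin (n + 1)) ℂ (Fin (n + 1) → ℂ) := Pi.basisFun ℂ _
  have hinv : B.toMatrix s * s.toMatrix B = 1 := B.toMatrix_mul_toMatrix_flip s
  obtain ⟨φ, hφ⟩ := exists_PhiUnit_eq (M := s.toMatrix B)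
    (fun j ↦ (hBℓ j.succ).trans (if_neg j.succ_ne_zero)) ((hBℓ 0).trans (if_pos rfl))
    (.of_mul_eq_one_right _ hinv)
  refine ⟨η, φ, fun f hf ↦ ?_⟩
  have hconj : B.toMatrix s * Phi f * s.toMatrix B =
      LinearMap.toMatrix B B (Matrix.toLin' (Phi f)) := by
    rw [← basis_toMatrix_mul_linearMap_toMatrix_mul_basis_toMatrix B s B s]
    congr 2
    exact (LinearMap.toMatrix'_toLin' _).symm
  rw [show Phi (φ : MA n) = s.toMatrix B from hφ, Matrix.inv_eq_left_inv hinv, hconj]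
  exact hB ⟨f, hf⟩

end NormalForm

end AffineSemigroup

theorem theorem1p1 (n : ℕ) (hn : 1 ≤ n) (𝒢 : Subsemigroup (AffineSemigroup.MA n))
    (hab : ∀ f ∈ 𝒢, ∀ g ∈ 𝒢, f * g = g * f) :
    (∃ (η : Composition (n + 1)) (φ : AffineSemigroup.GA n),
      AffineSemigroup.IsNormalForm 𝒢 η φ) ∧
    ∀ (η : Composition (n + 1)) (φ : AffineSemigroup.GA n),
      AffineSemigroup.IsNormalForm 𝒢 η φ →
      List.TFAE [
        AffineSemigroup.IsHypercyclic 𝒢,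
        Dense (AffineSemigroup.orbit (𝒢 : Set (AffineSemigroup.MA n))
          (AffineSemigroup.w₀ η φ)),
        (∃ Q : AddSubsemigroup (Fin n → ℂ),
          (Q : Set (Fin n → ℂ)) =
            AffineSemigroup.orbit (AffineSemigroup.affineLogs 𝒢 η φ) (AffineSemigroup.w₀ η φ)) ∧
          Dense (AffineSemigroup.orbit (AffineSemigroup.affineLogs 𝒢 η φ)
            (AffineSemigroup.w₀ η φ))] :=
  ⟨AffineSemigroup.exists_isNormalForm 𝒢 hab,
    fun _ _ hnf ↦ AffineSemigroup.tfae_of_isNormalForm hnf hab⟩
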